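/- Let $G=(V,E)$ be a finite simple graph, let $d_v\ge 1$ ($v\in V$) be integers, and put $d_A=\prod_{v\in A}d_v$ and $\mathcal R_A=\prod_{v\in A}\{1,\dots,d_v\}$ for $A\subseteq V$, and $\mathcal R=\mathcal R_V$. Let $\Delta_{\mathcal R}=\{p\in\mathbb R^{\mathcal R}: p_i>0 \text{ for all } i,\ \sum_i p_i=1\}$, and let $\mathcal M_G\subseteq\Delta_{\mathcal R}$ be the discrete graphical model of $G$, that is, the set of all $p\in\Delta_{\mathcal R}$ of the form $p_i=\prod_{C}\theta^{(C)}_{i_C}$ ($i\in\mathcal R$), where $C$ runs over the containment-maximal cliques of $G$, $i_C\in\mathcal R_C$ is the restriction of $i$ to $C$, and the parameters $\theta^{(C)}_{j}$ ($j\in\mathcal R_C$) are complex numbers. For $r\ge 1$ let $$\mathrm{Mixt}^r(\mathcal M_G)=\{\pi_1p^1+\dots+\pi_rp^r:\ \pi_j>0,\ \pi_1+\dots+\pi_r=1,\ p^1,\dots,p^r\in\mathcal M_G\}.$$ The dimension of a set $M\subseteq\mathbb R^{\mathcal R}$ is the dimension of its Zariski closure, i.e. the Krull dimension of $\mathbb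 R[p_i: i\in\mathcal R]/I(M)$, where $I(M)$ is the ideal of polynomials vanishing on $M$. The mixture model $\mathrm{Mixt}^r(\mathcal M_G)$ is called defective if its dimension is less than its expected dimension $r\dim(\mathcal M_G)+r-1$. Suppose that $G$ is a clique star with two cliques: $G$ is the union of two distinct maximal cliques $\widetilde C_1,\widetilde C_2$ (every vertex and every edge lies in one of them), $S=\widetilde C_1\cap\widetilde C_2$, and $C_i=\widetilde C_i\setminus S$. Let $r\ge 1$. Then: 1. if $r\le\max\{d_{C_1},d_{C_2}\}$, then $\dim\mathrm{Mixt}^r(\mathcal M_G)=\min\{d_S\cdot r(d_{C_1}+d_{C_2}-r)-1,\ d_Sd_{C_1}d_{C_2}-1\}$; 2. if $r\ge\max\{d_{C_1},d_{C_2}\}$, then $\dim\mathrm{Mixt}^r(\mathcal M_G)=d_Sd_{C_1}d_{C_2}-1$; 3. if $r\ge 2$, then $\mathrm{Mixt}^r(\mathcal M_G)$ is defective. -/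

import Mathlib

namespace GraphMixture

/-- The open probability simplex `{p : p_i > 0 for all i, ∑ p_i = 1}`. -/
def openSimplex (ι : Type*) [Fintype ι] : Set (ι → ℝ) :=
  {p | (∀ i, 0 < p i) ∧ ∑ i, p i = 1}

/-- The `r`-th mixture model of `M`: all `π₁ p¹ + ⋯ + πᵣ pʳ` with weights `π` in the open simplex
and `p¹, …, pʳ ∈ M`. -/
def mixture {ι : Type*} (r : ℕ) (M : Set (ι → ℝ)) : Set (ι → ℝ) :=
  {p | ∃ w ∈ openSimplex (Fin r), ∃ q : Fin r → ι → ℝ, (∀ j, q j ∈ M) ∧ p = ∑ j, w j • q j}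

/-- The dimension of a (semialgebraic) subset `M` of `ℝ^ι`, i.e. the dimension of its Zariski
closure: the Krull dimension of `ℝ[p_i : i ∈ ι] / I(M)`, where `I(M)` is the ideal of all
polynomials vanishing on `M`. -/
noncomputable def modelDim {ι : Type*} (M : Set (ι → ℝ)) : WithBot ℕ∞ :=
  ringKrullDim (MvPolynomial ι ℝ ⧸ MvPolynomial.vanishingIdeal ℝ M)

/-- The expected dimension `r · dim M + r - 1` of the `r`-th mixture model of `M` (for `r ≥ 1`). -/
noncomputable def expectedDim {ι : Type*} (r : ℕ) (M : Set (ι → ℝ)) : WithBot ℕ∞ :=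
  (r : WithBot ℕ∞) * modelDim M + ((r - 1 : ℕ) : WithBot ℕ∞)

/-- The `r`-th mixture model of `M` is defective: its dimension is less than the expected one. -/
def IsDefective {ι : Type*} (r : ℕ) (M : Set (ι → ℝ)) : Prop :=
  modelDim (mixture r M) < expectedDim r M

section Graph

variable {V : Type*} [Fintype V]

/-- A containment-maximal clique of `G`. -/
def IsMaxClique (G : SimpleGraph V) (C : Finset V) : Prop :=
  Maximal (fun s : Finset V => G.IsClique (s : Set V)) C

open Classical in
/-- The set `𝒞(G)` of maximal cliques of `G`. -/
noncomputable def maxCliques (G : SimpleGraph V) : Finset (Finset V) :=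
  Finset.univ.filter (fun C => IsMaxClique G C)

/-- The state space `ℛ_A = ∏_{v ∈ A} [d_v]` of the subvector indexed by `A`. -/
abbrev StateOn (d : V → ℕ) (A : Finset V) : Type _ := ∀ v : A, Fin (d v)

/-- The state space `ℛ = ∏_{v ∈ V} [d_v]`. -/
abbrev State (d : V → ℕ) : Type _ := ∀ v : V, Fin (d v)

/-- The number of states `d_A = ∏_{v ∈ A} d_v`. -/
def numStates (d : V → ℕ) (A : Finset V) : ℕ := ∏ v ∈ A, d v

/-- The monomial map `φ^G_i(θ) = ∏_{C ∈ 𝒞(G)} θ^{(C)}_{i_C}`, with complex parameters. -/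
noncomputable def monomialMap (G : SimpleGraph V) (d : V → ℕ)
    (θ : ∀ C : maxCliques G, StateOn d (C : Finset V) → ℂ) : State d → ℂ :=
  fun i => ∏ C : maxCliques G, θ C (fun v => i v)

/-- The discrete graphical model `ℳ_G`: the points of the open probability simplex in the image
of `φ^G`. -/
def graphicalModel [DecidableEq V] (G : SimpleGraph V) (d : V → ℕ) : Set (State d → ℝ) :=
  {p | p ∈ openSimplex (State d) ∧ ∃ θ, ∀ i, monomialMap G d θ i = (p i : ℂ)}

/-- `G` is the clique star with (distinct) maximal cliques `K 1, …, K k` and centre `S`: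
`G` is the union of the complete graphs on the `K i` (vertices and edges), `S` is a clique, and
`K i ∩ K j = S` for all `i ≠ j`. -/
structure IsCliqueStar [DecidableEq V] {k : ℕ} (G : SimpleGraph V) (K : Fin k → Finset V)
    (S : Finset V) : Prop where
  injective : Function.Injective K
  maxClique : ∀ i, IsMaxClique G (K i)
  vertex_mem : ∀ v, ∃ i, v ∈ K i
  edge_mem : ∀ v w, G.Adj v w → ∃ i, v ∈ K i ∧ w ∈ K i
  isClique : G.IsClique (S : Set V)
  inter_eq : ∀ i j, i ≠ j → K i ∩ K j = S

end Graph

end GraphMixture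

/-! A state splits as `(s, a, b)`, with `s` a state of the separator `S` and `a`, `b` states of
`C₁`, `C₂`. The two clique parameters see only `(s, a)` and `(s, b)`, so the model consists of the
positive normalized families of rank-one matrices, one `d₁ × d₂` matrix for each `s`. Scales can be
chosen separately for each `s`; hence, once normalization is dropped, an `r`-th mixture is any
family of products `U s * V s` with positive factors of inner size `r` (`positiveCone_mixture`).

Positivity is invisible to polynomials, so the Zariski closure of this cone is a product of `d_S`
varieties of matrices of rank at most `r`. The entries in `r` fixed rows or `r` fixed columns are a
transcendence basis of its coordinate ring: they can be prescribed generically, and they determine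
the other entries through a nonzero minor. This gives the dimension `d_S (d₁ d₂ - (d₁ - r)(d₂ - r))`
with truncated subtraction (`positiveProducts.ringKrullDim_quotient`), and slicing the cone by `∑ p
= 1` lowers it by one (`ringKrullDim_positiveCone`).

The three claims are then arithmetic. Defectivity says that the rank-`r` count is less than `r`
times the rank-one count `d₁ + d₂ - 1`. -/

/-! ### Krull dimension, integral extensions and transcendence degree -/

/-- Chains of primes lift along injective integral extensions. -/
theorem exists_ltSeries_comap_of_isIntegral {R S : Type*} [CommRing R] [CommRing S] [Algebra R S]
    [Algebra.IsIntegral R S] [FaithfulSMul R S] (l : LTSeries (PrimeSpectrum R)) :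
    ∃ l' : LTSeries (PrimeSpectrum S), l'.length = l.length ∧
      (l'.last).comap (algebraMap R S) = l.last := by
  induction l using RelSeries.inductionOn' with
  | singleton p =>
    obtain ⟨Q, -, hQ, hc⟩ := Ideal.exists_ideal_over_prime_of_isIntegral (S := S) p.asIdeal ⊥
      (by rw [← RingHom.ker_eq_comap_bot,
        (RingHom.injective_iff_ker_eq_bot _).1 (FaithfulSMul.algebraMap_injective R S)]
          exact bot_le)
    exact ⟨RelSeries.singleton _ ⟨Q, hQ⟩, rfl, PrimeSpectrum.ext hc⟩
  | snoc l p h ih =>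
    obtain ⟨l', hl, hc⟩ := ih
    have hlt : l.last < p := h
    obtain ⟨Q, hle, hQ, hcQ⟩ := Ideal.exists_ideal_over_prime_of_isIntegral (S := S) p.asIdeal
      l'.last.asIdeal (by
        have := congrArg PrimeSpectrum.asIdeal hc
        rw [PrimeSpectrum.comap_asIdeal] at this
        rw [this]; exact hlt.le)
    have hlt' : l'.last < ⟨Q, hQ⟩ := by
      refine lt_of_le_of_ne hle fun he => hlt.ne ?_
      rw [← hc, he]
      exact PrimeSpectrum.ext hcQ
    exact ⟨l'.snoc ⟨Q, hQ⟩ hlt', by simp [hl], by simpa using PrimeSpectrum.ext hcQ⟩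

/-- Incomparability of primes in an integral extension gives `≤`; lifting chains by lying over and
going up gives `≥`. -/
theorem ringKrullDim_eq_of_isIntegral (R S : Type*) [CommRing R] [CommRing S] [Algebra R S]
    [Algebra.IsIntegral R S] [FaithfulSMul R S] : ringKrullDim S = ringKrullDim R := by
  apply le_antisymm
  · refine Order.krullDim_le_of_strictMono (PrimeSpectrum.comap (algebraMap R S)) ?_
    intro I J h
    exact Ideal.IsIntegral.comap_lt_comap h
  · refine iSup_le fun l => ?_
    obtain ⟨l', hl, -⟩ := exists_ltSeries_comap_of_isIntegral (S := S) l
    rw [← hl]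
    exact Order.LTSeries.length_le_krullDim l'

/-- The Krull dimension of a finitely generated domain over a field is its transcendence degree. -/
theorem ringKrullDim_eq_of_trdeg_eq {k A : Type*} [Field k] [CommRing A] [IsDomain A] [Algebra k A]
    [Algebra.FiniteType k A] {n : ℕ} (h : Algebra.trdeg k A = n) : ringKrullDim A = n := by
  obtain ⟨s, g, hg, hi⟩ := exists_integral_inj_algHom_of_fg k A
  algebraize [g.toRingHom]
  have : FaithfulSMul (MvPolynomial (Fin s) k) A :=
    (faithfulSMul_iff_algebraMap_injective _ _).2 hg
  have : IsScalarTower k (MvPolynomial (Fin s) k) A :=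
    IsScalarTower.of_algebraMap_eq fun x => (g.commutes x).symm
  have hi' : Algebra.IsIntegral (MvPolynomial (Fin s) k) A := ⟨hi⟩
  rw [ringKrullDim_eq_of_isIntegral (MvPolynomial (Fin s) k) A,
    MvPolynomial.ringKrullDim_of_isNoetherianRing, ringKrullDim_eq_zero_of_field]
  have := lift_trdeg_add_eq k (MvPolynomial (Fin s) k) A
  rw [h, trdeg_eq_zero (R := MvPolynomial (Fin s) k)] at this
  simp at this
  simp [this]

theorem exists_trdeg_eq_nat (k A : Type*) [Field k] [CommRing A] [IsDomain A] [Algebra k A]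
    [Algebra.FiniteType k A] : ∃ n : ℕ, Algebra.trdeg k A = n :=
  Cardinal.lt_aleph0.1 trdeg_lt_aleph0_of_finiteType

/-- Finitely generated domains, algebraic one over the other, have the same Krull dimension. -/
theorem ringKrullDim_eq_of_isAlgebraic (k A B : Type*) [Field k] [CommRing A] [IsDomain A]
    [CommRing B] [IsDomain B] [Algebra k A] [Algebra k B] [Algebra.FiniteType k A]
    [Algebra.FiniteType k B] [Algebra A B] [IsScalarTower k A B] [FaithfulSMul A B]
    [Algebra.IsAlgebraic A B] : ringKrullDim A = ringKrullDim B := by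
  obtain ⟨n, hn⟩ := exists_trdeg_eq_nat k A
  obtain ⟨m, hm⟩ := exists_trdeg_eq_nat k B
  have := lift_trdeg_add_eq k A B
  rw [hn, hm, trdeg_eq_zero (R := A)] at this
  simp at this
  rw [ringKrullDim_eq_of_trdeg_eq hn, ringKrullDim_eq_of_trdeg_eq hm, this]

/-! ### The dimension of the cone over a set in the hyperplane `∑ p = 1` -/

/-- Since the `x i` sum to 1, the `y i` sum to `X`, which is therefore algebraic. Each `C (x i)` is
then algebraic because its product with `X` is, and the `x i` generate `A`. -/
theorem Polynomial.isAlgebraic_of_cone {k ι A B : Type*} [Fintype ι] [Field k] [CommRing A]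
    [IsDomain A] [Algebra k A] [CommRing B] [IsDomain B] [Algebra k B] [Algebra B (Polynomial A)]
    [IsScalarTower k B (Polynomial A)] {x : ι → A} {y : ι → B} (hsum : ∑ i, x i = 1)
    (hx : Algebra.adjoin k (Set.range x) = ⊤)
    (hy : ∀ i, algebraMap B (Polynomial A) (y i) = C (x i) * X) :
    Algebra.IsAlgebraic B (Polynomial A) := by
  have hX : IsAlgebraic B (X : Polynomial A) := by
    have := isAlgebraic_algebraMap (A := Polynomial A) (∑ i, y i)
    rwa [map_sum, Finset.sum_congr rfl (fun i _ => hy i), ← Finset.sum_mul, ← map_sum, hsum,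
      map_one, one_mul] at this
  have hC : ∀ a : A, IsAlgebraic B (C a) := by
    intro a
    have ha : a ∈ Algebra.adjoin k (Set.range x) := hx ▸ Algebra.mem_top
    induction ha using Algebra.adjoin_induction with
    | mem a h =>
      obtain ⟨i, rfl⟩ := h
      refine IsAlgebraic.of_mul (mem_nonZeroDivisors_of_ne_zero X_ne_zero) hX ?_
      rw [mul_comm, ← hy]
      exact isAlgebraic_algebraMap _
    | algebraMap r =>
      rw [← Polynomial.algebraMap_apply, IsScalarTower.algebraMap_apply k B]
      exact isAlgebraic_algebraMap _
    | add a b _ _ ha hb => rw [map_add]; exact ha.add hb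
    | mul a b _ _ ha hb => rw [map_mul]; exact ha.mul hb
  refine ⟨fun q => ?_⟩
  induction q using Polynomial.induction_on' with
  | add p q hp hq => exact hp.add hq
  | monomial n a =>
    rw [← Polynomial.C_mul_X_pow_eq_monomial]
    exact (hC a).mul (hX.pow n)

theorem ringKrullDim_eq_add_one_of_cone {k ι A B : Type*} [Fintype ι] [Field k] [CommRing A]
    [IsDomain A] [Algebra k A] [Algebra.FiniteType k A] [CommRing B] [IsDomain B] [Algebra k B]
    [Algebra.FiniteType k B] (g : B →ₐ[k] Polynomial A) (hg : Function.Injective g) {x : ι → A}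
    {y : ι → B} (hsum : ∑ i, x i = 1) (hx : Algebra.adjoin k (Set.range x) = ⊤)
    (hy : ∀ i, g (y i) = Polynomial.C (x i) * Polynomial.X) :
    ringKrullDim B = ringKrullDim A + 1 := by
  have : IsNoetherianRing A := Algebra.FiniteType.isNoetherianRing k A
  rw [← Polynomial.ringKrullDim_of_isNoetherianRing]
  let _ : Algebra B (Polynomial A) := @RingHom.toAlgebra _ _ _ Polynomial.commSemiring g.toRingHom
  have : FaithfulSMul B (Polynomial A) := (faithfulSMul_iff_algebraMap_injective _ _).2 hg
  have : IsScalarTower k B (Polynomial A) :=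
    IsScalarTower.of_algebraMap_eq fun x => (g.commutes x).symm
  have := Polynomial.isAlgebraic_of_cone (B := B) hsum hx hy
  exact ringKrullDim_eq_of_isAlgebraic k _ _

/-- The cone over `M`. -/
def positiveCone {ι : Type*} (M : Set (ι → ℝ)) : Set (ι → ℝ) :=
  {x | ∃ t : ℝ, 0 < t ∧ ∃ p ∈ M, x = t • p}

namespace MvPolynomial

variable {ι : Type*}

theorem aeval_smul_point [Fintype ι] {f : MvPolynomial ι ℝ} {n : ℕ} (hf : f.IsHomogeneous n)
    (t : ℝ) (p : ι → ℝ) : aeval (t • p) f = t ^ n * aeval p f := by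
  simp only [aeval_def, eval₂_eq', Finset.mul_sum]
  refine Finset.sum_congr rfl fun m hm => ?_
  have hd : ∑ i, m i = n := by
    have := hf (mem_support_iff.1 hm)
    rwa [Finsupp.weight_apply, Finsupp.sum_fintype _ _ (by simp), ← Finset.sum_congr rfl
      (fun i _ => show m i = m i • (1 : ι → ℕ) i by simp)] at this
  simp only [Pi.smul_apply, smul_eq_mul, mul_pow, Finset.prod_mul_distrib, Finset.prod_pow_eq_pow_sum,
    hd]
  ring

/-- Homogenization with respect to the sum of all variables. -/
theorem exists_homogenization [Fintype ι] (f : MvPolynomial ι ℝ) :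
    ∃ (g : MvPolynomial ι ℝ) (n : ℕ), ∀ (t : ℝ) (p : ι → ℝ), ∑ i, p i = 1 →
      aeval (t • p) g = t ^ n * aeval p f := by
  -- At `t • p` with `∑ p = 1` the form `∑ X i` has the value `t`, so its powers supply the missing
  -- degrees without affecting values at `t = 1`.
  refine ⟨∑ k ∈ Finset.range (f.totalDegree + 1),
    homogeneousComponent k f * (∑ i, X i) ^ (f.totalDegree - k), f.totalDegree, fun t p hp => ?_⟩
  conv_rhs => rw [show aeval p f = aeval p (∑ k ∈ Finset.range (f.totalDegree + 1),
    homogeneousComponent k f) by rw [sum_homogeneousComponent]]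
  rw [map_sum, map_sum, Finset.mul_sum]
  refine Finset.sum_congr rfl fun k hk => ?_
  have hk' : k ≤ f.totalDegree := by simpa [Nat.lt_succ_iff] using hk
  rw [map_mul, aeval_smul_point (homogeneousComponent_isHomogeneous k f), map_pow, map_sum]
  simp only [aeval_X, Pi.smul_apply, smul_eq_mul, ← Finset.mul_sum, hp, mul_one]
  rw [mul_right_comm, ← pow_add, Nat.add_sub_cancel' hk']

/-- A polynomial vanishes on `M` exactly when its homogenization vanishes on the cone, so a product
in `I(M)` can be tested in the prime ideal of the cone. -/
theorem vanishingIdeal_isPrime_of_positiveCone [Fintype ι] {M : Set (ι → ℝ)}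
    (hM : ∀ p ∈ M, ∑ i, p i = 1)
    (hJ : (vanishingIdeal ℝ (positiveCone M)).IsPrime) : (vanishingIdeal ℝ M).IsPrime := by
  refine ⟨fun h => hJ.ne_top ?_, fun {f g} hfg => ?_⟩
  · rw [Ideal.eq_top_iff_one] at h ⊢
    rintro _ ⟨t, -, p, hp, rfl⟩
    simpa using h p hp
  · obtain ⟨f', n, hf⟩ := exists_homogenization f
    obtain ⟨g', m, hg⟩ := exists_homogenization g
    have key : ∀ (f f' : MvPolynomial ι ℝ) (n : ℕ), (∀ (t : ℝ) (p : ι → ℝ), ∑ i, p i = 1 →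
        aeval (t • p) f' = t ^ n * aeval p f) → f' ∈ vanishingIdeal ℝ (positiveCone M) →
        f ∈ vanishingIdeal ℝ M := by
      intro f f' n h h' p hp
      have := h' _ ⟨1, one_pos, p, hp, rfl⟩
      rw [h 1 p (hM p hp)] at this
      simpa using this
    refine (hJ.mem_or_mem (x := f') (y := g') ?_).imp (key f f' n hf) (key g g' m hg)
    rintro _ ⟨t, -, p, hp, rfl⟩
    have := hfg p hp
    rw [map_mul] at this
    rw [map_mul, hf t p (hM p hp), hg t p (hM p hp), mul_mul_mul_comm, this, mul_zero]

/-- Evaluation at a point of `M` on the coordinate ring of `M`. -/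
noncomputable def evalPoint {M : Set (ι → ℝ)} (p : M) :
    (MvPolynomial ι ℝ ⧸ vanishingIdeal ℝ M) →ₐ[ℝ] ℝ :=
  Ideal.Quotient.liftₐ _ (aeval (p : ι → ℝ)) fun _ hf => hf p p.2

theorem eq_zero_of_evalPoint {M : Set (ι → ℝ)} (a : MvPolynomial ι ℝ ⧸ vanishingIdeal ℝ M)
    (h : ∀ p : M, evalPoint p a = 0) : a = 0 := by
  obtain ⟨f, rfl⟩ := Ideal.Quotient.mk_surjective a
  rw [Ideal.Quotient.eq_zero_iff_mem]
  intro p hp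
  exact h ⟨p, hp⟩

/-- The map `x_i ↦ x_i T` into polynomials over the coordinate ring of `M`. -/
noncomputable def coneMap (M : Set (ι → ℝ)) :
    MvPolynomial ι ℝ →ₐ[ℝ] Polynomial (MvPolynomial ι ℝ ⧸ vanishingIdeal ℝ M) :=
  aeval (S₁ := Polynomial (MvPolynomial ι ℝ ⧸ vanishingIdeal ℝ M))
    fun i => Polynomial.C (Ideal.Quotient.mk (vanishingIdeal ℝ M) (X i)) * Polynomial.X

theorem eval_coneMap {M : Set (ι → ℝ)} (p : M) (t : ℝ) (f : MvPolynomial ι ℝ) :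
    ((coneMap M f).map (evalPoint p : _ →+* ℝ)).eval t = aeval (t • (p : ι → ℝ)) f := by
  have : (Polynomial.evalRingHom t).comp ((Polynomial.mapRingHom (evalPoint p : _ →+* ℝ)).comp
      (coneMap M).toRingHom) =
      ((aeval (t • (p : ι → ℝ)) : MvPolynomial ι ℝ →ₐ[ℝ] ℝ) : MvPolynomial ι ℝ →+* ℝ) := by
    apply MvPolynomial.ringHom_ext
    · intro r
      have h₁ : coneMap M (C r) = Polynomial.C (Ideal.Quotient.mk _ (C r)) :=
        (coneMap M).commutes r
      have h₂ : evalPoint p (Ideal.Quotient.mk _ (C r)) = r := aeval_C _ r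
      have h₃ : aeval (t • (p : ι → ℝ)) (C r : MvPolynomial ι ℝ) = r := aeval_C _ r
      change ((coneMap M (C r)).map (evalPoint p : _ →+* ℝ)).eval t = aeval _ (C r)
      rw [h₁, h₃, Polynomial.map_C, Polynomial.eval_C]
      exact h₂
    · intro i
      have h₁ : coneMap M (X i) = Polynomial.C (Ideal.Quotient.mk _ (X i)) * Polynomial.X :=
        aeval_X _ i
      have h₂ : evalPoint p (Ideal.Quotient.mk _ (X i)) = (p : ι → ℝ) i :=
        aeval_X (p : ι → ℝ) i
      change ((coneMap M (X i)).map (evalPoint p : _ →+* ℝ)).eval t = aeval _ (X i)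
      rw [h₁, aeval_X, Polynomial.map_mul, Polynomial.map_C, Polynomial.map_X, Polynomial.eval_mul,
        Polynomial.eval_C, Polynomial.eval_X, RingHom.coe_coe, h₂, Pi.smul_apply, smul_eq_mul, mul_comm]
  exact congrArg (fun g => g f) this

/-- For fixed `p` in `M`, a polynomial in `T` vanishing at all `t > 0` is zero; its coefficients
thus vanish at every point of `M`. Hence `coneMap` embeds the coordinate ring of the cone in
polynomials over that of `M`. -/
theorem coneMap_eq_zero_iff {M : Set (ι → ℝ)} (f : MvPolynomial ι ℝ) :
    coneMap M f = 0 ↔ f ∈ vanishingIdeal ℝ (positiveCone M) := by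
  constructor
  · rintro h _ ⟨t, -, p, hp, rfl⟩
    rw [← eval_coneMap ⟨p, hp⟩, h]
    simp
  · intro h
    ext n
    rw [Polynomial.coeff_zero]
    refine eq_zero_of_evalPoint _ fun p => ?_
    have : (coneMap M f).map (evalPoint p : _ →+* ℝ) = 0 := by
      refine Polynomial.eq_zero_of_infinite_isRoot _ ((Set.Ioi_infinite (0 : ℝ)).mono ?_)
      intro t ht
      rw [Set.mem_ofPred_eq, Polynomial.IsRoot, eval_coneMap]
      exact h _ ⟨t, ht, p, p.2, rfl⟩
    simpa using congrArg (fun q => Polynomial.coeff q n) this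

theorem ringKrullDim_positiveCone [Fintype ι] {M : Set (ι → ℝ)} (hM : ∀ p ∈ M, ∑ i, p i = 1)
    (hJ : (vanishingIdeal ℝ (positiveCone M)).IsPrime) :
    ringKrullDim (MvPolynomial ι ℝ ⧸ vanishingIdeal ℝ (positiveCone M)) =
      ringKrullDim (MvPolynomial ι ℝ ⧸ vanishingIdeal ℝ M) + 1 := by
  have hI := vanishingIdeal_isPrime_of_positiveCone hM hJ
  let g : (MvPolynomial ι ℝ ⧸ vanishingIdeal ℝ (positiveCone M)) →ₐ[ℝ]
      Polynomial (MvPolynomial ι ℝ ⧸ vanishingIdeal ℝ M) :=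
    Ideal.Quotient.liftₐ _ (coneMap M) fun f hf => (coneMap_eq_zero_iff f).2 hf
  refine ringKrullDim_eq_add_one_of_cone g ?_
    (x := fun i => Ideal.Quotient.mk _ (X i)) (y := fun i => Ideal.Quotient.mk _ (X i)) ?_ ?_ ?_
  · rw [injective_iff_map_eq_zero]
    intro a ha
    obtain ⟨f, rfl⟩ := Ideal.Quotient.mk_surjective a
    rw [Ideal.Quotient.eq_zero_iff_mem]
    exact (coneMap_eq_zero_iff f).1 ha
  · rw [← map_sum, ← map_one (Ideal.Quotient.mk _), Ideal.Quotient.eq]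
    intro p hp
    simp [hM p hp]
  · rw [eq_top_iff]
    rintro a -
    obtain ⟨f, rfl⟩ := Ideal.Quotient.mk_surjective a
    have h := Algebra.adjoin_range_eq_range_aeval ℝ (fun i => Ideal.Quotient.mk (vanishingIdeal ℝ M) (X i : MvPolynomial ι ℝ))
    rw [h]
    refine ⟨f, ?_⟩
    exact congrArg (fun φ : MvPolynomial ι ℝ →ₐ[ℝ] _ => φ f)
      (show aeval _ = Ideal.Quotient.mkₐ ℝ (vanishingIdeal ℝ M) by ext i; simp)
  · intro i
    exact aeval_X _ i

end MvPolynomial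

/-! ### Families of matrix products and their vanishing ideal -/

open MvPolynomial

/-- A family of matrices indexed by `σ`, each the product of `U s` and `V s`, as a point. -/
def productPoint {σ α β κ R : Type*} [Fintype κ] [CommRing R] (U : σ → Matrix α κ R)
    (V : σ → Matrix κ β R) : σ × α × β → R :=
  fun i => (U i.1 * V i.1) i.2.1 i.2.2

/-- Families of matrices with a factorization of size `κ` into matrices with positive entries. -/
def positiveProducts (σ α β κ : Type*) [Fintype κ] : Set (σ × α × β → ℝ) :=
  {x | ∃ U V, (∀ s a j, 0 < U s a j) ∧ (∀ s j b, 0 < V s j b) ∧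
    x = productPoint (κ := κ) U V}

namespace positiveProducts

section Prime

variable {σ α β κ : Type*} [Fintype κ]

/-- The product of two families of generic matrices. -/
noncomputable def genericProduct (σ α β κ : Type*) [Fintype κ] :
    σ × α × β → MvPolynomial ((σ × α × κ) ⊕ (σ × κ × β)) ℝ :=
  productPoint (fun s => Matrix.of fun a j => X (Sum.inl (s, a, j)))
    (fun s => Matrix.of fun j b => X (Sum.inr (s, j, b)))

theorem eval_genericProduct (θ : (σ × α × κ) ⊕ (σ × κ × β) → ℝ) (f : MvPolynomial (σ × α × β) ℝ) :
    eval θ (aeval (genericProduct σ α β κ) f) =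
      aeval (productPoint (fun s => Matrix.of fun a j => θ (Sum.inl (s, a, j)))
        (fun s => Matrix.of fun j b => θ (Sum.inr (s, j, b)))) f := by
  rw [← coe_aeval_eq_eval, RingHom.coe_coe, ← AlgHom.comp_apply]
  congr 1
  ext i
  simp [genericProduct, productPoint, Matrix.mul_apply]

/-- The positive orthant is Zariski dense in parameter space, so vanishing at all positive factors
is an identity in generic factors. The ideal is thus the kernel of a map to a domain. -/
theorem mem_vanishingIdeal_iff_aeval (f : MvPolynomial (σ × α × β) ℝ) :
    f ∈ vanishingIdeal ℝ (positiveProducts σ α β κ) ↔ aeval (genericProduct σ α β κ) f = 0 := by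
  constructor
  · intro h
    refine funext_set (fun _ => Set.Ioi 0) (fun _ => Set.Ioi_infinite 0) fun θ hθ => ?_
    rw [eval_genericProduct, map_zero]
    exact h _ ⟨_, _, fun s a j => hθ _ trivial, fun s j b => hθ _ trivial, rfl⟩
  · rintro h _ ⟨U, V, -, -, rfl⟩
    have := eval_genericProduct (Sum.elim (fun i => U i.1 i.2.1 i.2.2)
      (fun i => V i.1 i.2.1 i.2.2)) f
    rw [h, map_zero] at this
    exact this.symm

theorem vanishingIdeal_isPrime : (vanishingIdeal ℝ (positiveProducts σ α β κ)).IsPrime := by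
  have : vanishingIdeal ℝ (positiveProducts σ α β κ) =
      RingHom.ker (aeval (R := ℝ) (genericProduct σ α β κ)) :=
    Ideal.ext fun f => mem_vanishingIdeal_iff_aeval f
  rw [this]
  exact RingHom.ker_isPrime _

/-- Dropping positivity of the factors allows test points with entries 0 and 1 later. -/
theorem aeval_productPoint_eq_zero {f : MvPolynomial (σ × α × β) ℝ}
    (hf : f ∈ vanishingIdeal ℝ (positiveProducts σ α β κ)) (U : σ → Matrix α κ ℝ)
    (V : σ → Matrix κ β ℝ) : aeval (productPoint U V) f = 0 := by
  rw [mem_vanishingIdeal_iff_aeval] at hf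
  have := eval_genericProduct (Sum.elim (fun i => U i.1 i.2.1 i.2.2)
    (fun i => V i.1 i.2.1 i.2.2)) f
  rw [hf, map_zero] at this
  exact this.symm

end Prime

/-- A factorization through an index set at least as large as the rows or the columns always
exists. -/
theorem exists_productPoint_eq {σ : Type*} {r d₁ d₂ : ℕ} (h : d₁ ≤ r ∨ d₂ ≤ r)
    (x : σ × Fin d₁ × Fin d₂ → ℝ) :
    ∃ (U : σ → Matrix (Fin d₁) (Fin r) ℝ) (V : σ → Matrix (Fin r) (Fin d₂) ℝ),
      x = productPoint U V := by
  rcases h with h | h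
  -- An identity block padded by zero columns, times `x` padded by zero rows; the other case is the
  -- transpose of this.
  · refine ⟨fun s => Matrix.of fun a j => if j = Fin.castLE h a then 1 else 0,
      fun s => Matrix.of fun j b => if hj : j.1 < d₁ then x (s, ⟨j, hj⟩, b) else 0, ?_⟩
    ext ⟨s, a, b⟩
    simp only [productPoint, Matrix.mul_apply, Matrix.of_apply]
    rw [Finset.sum_eq_single (Fin.castLE h a) (by intro j _ hj; simp [hj]) (by simp)]
    simp
  · refine ⟨fun s => Matrix.of fun a j => if hj : j.1 < d₂ then x (s, a, ⟨j, hj⟩) else 0,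
      fun s => Matrix.of fun j b => if j = Fin.castLE h b then 1 else 0, ?_⟩
    ext ⟨s, a, b⟩
    simp [productPoint, Matrix.mul_apply]

theorem vanishingIdeal_eq_bot {σ : Type*} {r d₁ d₂ : ℕ} (h : d₁ ≤ r ∨ d₂ ≤ r) :
    vanishingIdeal ℝ (positiveProducts σ (Fin d₁) (Fin d₂) (Fin r)) = ⊥ := by
  rw [eq_bot_iff]
  intro f hf
  rw [Ideal.mem_bot]
  refine MvPolynomial.funext fun x => ?_
  obtain ⟨U, V, rfl⟩ := exists_productPoint_eq h x
  rw [map_zero, ← aeval_productPoint_eq_zero hf U V, aeval_eq_eval]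

/-- The entries outside a block of a product matrix are determined by those in its rows and
columns. -/
theorem _root_.Matrix.submatrix_mul_adjugate_mul_submatrix {α β κ R : Type*} [Fintype κ]
    [DecidableEq κ] [CommRing R] (U : Matrix α κ R) (V : Matrix κ β R) (b : κ → α) (c : κ → β) :
    (U * V).submatrix id c * ((U * V).submatrix b c).adjugate * (U * V).submatrix b id =
      ((U * V).submatrix b c).det • (U * V) := by
  have h₁ : (U * V).submatrix id c = U * V.submatrix id c := rfl
  have h₂ : (U * V).submatrix b id = U.submatrix b id * V := rfl
  have h₃ : (U * V).submatrix b c = U.submatrix b id * V.submatrix id c := rfl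
  rw [h₁, h₂, h₃, Matrix.adjugate_mul_distrib, Matrix.det_mul]
  calc _ = U * (V.submatrix id c * (V.submatrix id c).adjugate) *
        ((U.submatrix b id).adjugate * U.submatrix b id) * V := by simp only [Matrix.mul_assoc]
    _ = _ := by
      rw [Matrix.mul_adjugate, Matrix.adjugate_mul]
      simp [smul_smul]

/-- A matrix with an invertible block agrees with a product in the rows and columns of this
block. -/
theorem _root_.Matrix.exists_mul_eq_of_isUnit_submatrix {α β κ R : Type*} [Fintype κ]
    [DecidableEq κ] [CommRing R] (N : Matrix α β R) (b : κ → α) (c : κ → β)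
    (h : IsUnit (N.submatrix b c).det) : ∃ (U : Matrix α κ R) (V : Matrix κ β R),
      (∀ i y, (U * V) (b i) y = N (b i) y) ∧ ∀ x j, (U * V) x (c j) = N x (c j) := by
  refine ⟨N.submatrix id c * (N.submatrix b c)⁻¹, N.submatrix b id, fun i y => ?_, fun x j => ?_⟩
  · have : (N.submatrix id c * (N.submatrix b c)⁻¹ * N.submatrix b id).submatrix b id =
        N.submatrix b c * (N.submatrix b c)⁻¹ * N.submatrix b id := rfl
    rw [Matrix.mul_nonsing_inv _ h, Matrix.one_mul] at this
    exact congrFun (congrFun this i) y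
  · have : (N.submatrix id c * (N.submatrix b c)⁻¹ * N.submatrix b id).submatrix id c =
        N.submatrix id c * (N.submatrix b c)⁻¹ * N.submatrix b c := rfl
    rw [Matrix.mul_assoc _ _ (N.submatrix b c), Matrix.nonsing_inv_mul _ h, Matrix.mul_one] at this
    exact congrFun (congrFun this x) j

/-- Over the coordinate ring the generic matrix need not come with a factorization; its evaluations
do, so the adjugate identity is transported through a ring homomorphism `φ`. -/
theorem _root_.Matrix.map_submatrix_mul_adjugate {α β κ R A : Type*} [Fintype κ]
    [DecidableEq κ] [CommRing R] [CommRing A] (φ : A →+* R) (W : Matrix α β A) (U : Matrix α κ R)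
    (V : Matrix κ β R) (h : W.map φ = U * V) (b : κ → α) (c : κ → β) (x : α) (y : β) :
    φ ((W.submatrix id c * (W.submatrix b c).adjugate * W.submatrix b id) x y) =
      φ (((W.submatrix b c).det • W) x y) := by
  have key := Matrix.submatrix_mul_adjugate_mul_submatrix U V b c
  rw [← h, Matrix.submatrix_map, Matrix.submatrix_map, Matrix.submatrix_map,
    ← RingHom.mapMatrix_apply φ (W.submatrix b c), ← RingHom.map_adjugate, ← RingHom.map_det,
    RingHom.mapMatrix_apply, ← Matrix.map_mul, ← Matrix.map_mul] at key
  have := congrFun (congrFun key x) y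
  simpa using this

theorem _root_.Matrix.det_mem {κ A : Type*} [Fintype κ] [DecidableEq κ] [CommRing A]
    (C : Subring A) (N : Matrix κ κ A) (h : ∀ i j, N i j ∈ C) : N.det ∈ C := by
  have : N = C.subtype.mapMatrix (Matrix.of fun i j => (⟨N i j, h i j⟩ : C)) := rfl
  rw [this, ← RingHom.map_det]
  exact Subtype.prop _

theorem _root_.Matrix.adjugate_mem {κ A : Type*} [Fintype κ] [DecidableEq κ] [CommRing A]
    (C : Subring A) (N : Matrix κ κ A) (h : ∀ i j, N i j ∈ C) (i j : κ) : N.adjugate i j ∈ C := by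
  have : N = C.subtype.mapMatrix (Matrix.of fun i j => (⟨N i j, h i j⟩ : C)) := rfl
  rw [this, ← RingHom.map_adjugate]
  exact Subtype.prop _

/-! ### The entries in fixed rows or columns as a transcendence basis -/

section Basis

variable {σ α β κ : Type*} [Fintype κ] [DecidableEq κ]

/-- The coordinates in the rows `b` or the columns `c`. -/
def frame (σ : Type*) (b : κ → α) (c : κ → β) : Set (σ × α × β) :=
  {i | i.2.1 ∈ Set.range b ∨ i.2.2 ∈ Set.range c}

/-- Frame entries whose blocks are all invertible extend to a family of products. A relation `f`
among frame coordinates therefore vanishes wherever the product of the block determinants does not,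
so `f` times that product is the zero polynomial. -/
theorem algebraicIndependent_frame [Fintype σ] [DecidableEq α] [DecidableEq β] {b : κ → α}
    {c : κ → β} (hb : Function.Injective b) (hc : Function.Injective c) :
    AlgebraicIndependent ℝ (fun i : frame σ b c =>
      Ideal.Quotient.mk (vanishingIdeal ℝ (positiveProducts σ α β κ)) (X (i : σ × α × β))) := by
  rw [algebraicIndependent_iff]
  intro f hf
  have hmem : rename (Subtype.val : frame σ b c → _) f ∈
      vanishingIdeal ℝ (positiveProducts σ α β κ) := by
    rw [← Ideal.Quotient.eq_zero_iff_mem, ← hf, ← Ideal.Quotient.mkₐ_eq_mk ℝ, ← AlgHom.comp_apply]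
    congr 1
    ext i
    simp
  let D : σ → MvPolynomial (frame σ b c) ℝ := fun s =>
    (Matrix.of fun i j : κ => (X ⟨(s, b i, c j), Or.inl ⟨i, rfl⟩⟩ : MvPolynomial _ ℝ)).det
  have hD : ∀ (m : frame σ b c → ℝ) s, eval m (D s) =
      (Matrix.of fun i j : κ => m ⟨(s, b i, c j), Or.inl ⟨i, rfl⟩⟩).det := by
    intro m s
    rw [RingHom.map_det]
    congr 1
    ext i j
    simp
  have hprod : ∏ s, D s ≠ 0 := by
    rw [Finset.prod_ne_zero_iff]
    rintro s - h0
    -- At this point every block is the identity, so no block determinant is the zero polynomial.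
    have := hD (fun e => if ∃ i, b i = e.1.2.1 ∧ c i = e.1.2.2 then 1 else 0) s
    rw [h0, map_zero] at this
    have h1 : (Matrix.of fun i j : κ => if ∃ k, b k = b i ∧ c k = c j then (1 : ℝ) else 0) = 1 := by
      ext i j
      simp [hb.eq_iff, hc.eq_iff, Matrix.one_apply]
    erw [h1] at this
    simp at this
  refine (mul_eq_zero.1 (?_ : f * ∏ s, D s = 0)).resolve_right hprod
  refine MvPolynomial.funext fun m => ?_
  rw [map_mul, map_zero, map_prod]
  by_cases h0 : ∃ s, eval m (D s) = 0
  · obtain ⟨s, hs⟩ := h0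
    rw [Finset.prod_eq_zero (Finset.mem_univ s) hs, mul_zero]
  · push Not at h0
    classical
    -- The value 0 off the frame is arbitrary: only the rows `b` and columns `c` of `N` are
    -- reproduced.
    let N : σ → Matrix α β ℝ := fun s => Matrix.of fun x y =>
      if h : (s, x, y) ∈ frame σ b c then m ⟨_, h⟩ else 0
    have hN : ∀ s, ∃ (U : Matrix α κ ℝ) (V : Matrix κ β ℝ),
      (∀ i y, (U * V) (b i) y = N s (b i) y) ∧ ∀ x j, (U * V) x (c j) = N s x (c j) := by
      intro s
      refine Matrix.exists_mul_eq_of_isUnit_submatrix (N s) b c ?_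
      rw [isUnit_iff_ne_zero]
      convert! h0 s using 1
      rw [hD]
      congr 1
      ext i j
      have : (s, b i, c j) ∈ frame σ b c := Or.inl ⟨i, rfl⟩
      simp [N, this]
    choose U V h1 h2 using hN
    have := aeval_productPoint_eq_zero hmem U V
    rw [aeval_rename] at this
    have hm : productPoint U V ∘ Subtype.val = m := by
      ext ⟨⟨s, x, y⟩, h⟩
      have hNm : N s x y = m ⟨_, h⟩ := by simp [N, h]
      rw [← hNm]
      rcases id h with ⟨i, hi⟩ | ⟨j, hj⟩
      · change (U s * V s) x y = _
        rw [← show b i = x from hi, h1]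
      · change (U s * V s) x y = _
        rw [← show c j = y from hj, h2]
    rw [hm, aeval_eq_eval] at this
    rw [this, zero_mul]

/-- The adjugate identity writes the block determinant times any entry as a polynomial in frame
entries. That determinant is nonzero in a domain and algebraic over the frame, so the entry is
algebraic too. -/
theorem isAlgebraic_adjoin_frame [DecidableEq α] [DecidableEq β] {b : κ → α}
    {c : κ → β} (hb : Function.Injective b) (hc : Function.Injective c) :
    Algebra.IsAlgebraic (Algebra.adjoin ℝ (Set.range fun i : frame σ b c =>
      Ideal.Quotient.mk (vanishingIdeal ℝ (positiveProducts σ α β κ)) (X (i : σ × α × β))))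
      (MvPolynomial (σ × α × β) ℝ ⧸ vanishingIdeal ℝ (positiveProducts σ α β κ)) := by
  have hprime := vanishingIdeal_isPrime (σ := σ) (α := α) (β := β) (κ := κ)
  set A := MvPolynomial (σ × α × β) ℝ ⧸ vanishingIdeal ℝ (positiveProducts σ α β κ) with hA
  set B := Algebra.adjoin ℝ (Set.range fun i : frame σ b c =>
      Ideal.Quotient.mk (vanishingIdeal ℝ (positiveProducts σ α β κ)) (X (i : σ × α × β))) with hB
  let W : σ → Matrix α β A := fun s => Matrix.of fun x y => Ideal.Quotient.mk _ (X (s, x, y))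
  let C : Subring A := (Subalgebra.algebraicClosure B A).toSubring
  have hWid : ∀ s, (W s).submatrix id c * ((W s).submatrix b c).adjugate * (W s).submatrix b id =
      ((W s).submatrix b c).det • (W s) := by
    intro s
    ext x y
    rw [← sub_eq_zero]
    refine eq_zero_of_evalPoint _ fun p => ?_
    obtain ⟨U, V, -, -, hp⟩ := p.2
    rw [map_sub, sub_eq_zero]
    refine Matrix.map_submatrix_mul_adjugate (evalPoint p : _ →+* ℝ)
      (W s) (U s) (V s) ?_ b c x y
    ext x y
    exact (aeval_X p.1 _).trans (congrFun hp (s, x, y))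
  have hframe : ∀ s x y, (s, x, y) ∈ frame σ b c → W s x y ∈ C := by
    intro s x y h
    exact isAlgebraic_algebraMap (⟨W s x y, Algebra.subset_adjoin ⟨⟨_, h⟩, rfl⟩⟩ : B)
  have hblock : ∀ s i j, (W s).submatrix b c i j ∈ C := fun s i j =>
    hframe _ _ _ (Or.inl ⟨i, rfl⟩)
  have hdet : ∀ s, ((W s).submatrix b c).det ∈ C := fun s => Matrix.det_mem C _ (hblock s)
  have hadj : ∀ s i j, ((W s).submatrix b c).adjugate i j ∈ C := fun s =>
    Matrix.adjugate_mem C _ (hblock s)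
  have hdet0 : ∀ s, ((W s).submatrix b c).det ≠ 0 := by
    intro s h
    let N : Matrix κ κ (MvPolynomial (σ × α × β) ℝ) := Matrix.of fun i j => X (s, b i, c j)
    have hN : (W s).submatrix b c = (Ideal.Quotient.mk _).mapMatrix N := rfl
    rw [hN, ← RingHom.map_det, Ideal.Quotient.eq_zero_iff_mem] at h
    -- The product of these indicator matrices has the identity as its block, so the determinant
    -- takes the value 1.
    have h1 := aeval_productPoint_eq_zero h (fun _ => Matrix.of fun x j => if x = b j then 1 else 0)
      (fun _ => Matrix.of fun j y => if y = c j then 1 else 0)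
    rw [AlgHom.map_det] at h1
    refine one_ne_zero (α := ℝ) ?_
    rw [← h1, ← Matrix.det_one (n := κ)]
    congr 1
    ext i j
    simp [N, productPoint, Matrix.mul_apply, hb.eq_iff, hc.eq_iff, Matrix.one_apply]
  have hX : ∀ s x y, W s x y ∈ C := by
    intro s x y
    refine IsAlgebraic.of_mul (mem_nonZeroDivisors_of_ne_zero (hdet0 s)) (hdet s) ?_
    have := congrFun (congrFun (hWid s) x) y
    rw [Matrix.smul_apply, smul_eq_mul] at this
    rw [← this]
    change _ ∈ C
    simp only [Matrix.mul_apply, Matrix.submatrix_apply, id]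
    refine sum_mem fun j _ => mul_mem (sum_mem fun i _ => mul_mem ?_ (hadj s i j)) ?_
    · exact hframe _ _ _ (Or.inr ⟨i, rfl⟩)
    · exact hframe _ _ _ (Or.inl ⟨j, rfl⟩)
  refine ⟨fun a => ?_⟩
  obtain ⟨f, rfl⟩ := Ideal.Quotient.mk_surjective a
  change _ ∈ C
  induction f using MvPolynomial.induction_on with
  | C r =>
    exact isAlgebraic_algebraMap (algebraMap ℝ B r)
  | add f g hf hg => rw [map_add]; exact add_mem hf hg
  | mul_X f i hf => rw [map_mul]; exact mul_mem hf (hX i.1 i.2.1 i.2.2)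

end Basis

end positiveProducts

/-! ### Dimension of the variety of matrix families -/

open MvPolynomial

namespace positiveProducts

/-- The complement of the frame is a `(d₁ - r) × (d₂ - r)` block for each `s`. -/
theorem natCard_frame {σ : Type*} [Fintype σ] {r d₁ d₂ : ℕ} (h₁ : r ≤ d₁) (h₂ : r ≤ d₂) :
    Nat.card (frame σ (Fin.castLE h₁) (Fin.castLE h₂)) =
      Fintype.card σ * (d₁ * d₂ - (d₁ - r) * (d₂ - r)) := by
  have hc : ∀ d (h : r ≤ d), (Set.range (Fin.castLE h))ᶜ.ncard = d - r := by
    intro d h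
    rw [Set.ncard_compl, Set.ncard_range_of_injective (Fin.castLE_injective h)]
    simp
  have hcompl : (frame σ (Fin.castLE h₁) (Fin.castLE h₂))ᶜ =
      Set.univ ×ˢ ((Set.range (Fin.castLE h₁))ᶜ ×ˢ (Set.range (Fin.castLE h₂))ᶜ) := by
    ext i
    simp [frame]
  have := Set.ncard_add_ncard_compl (frame σ (Fin.castLE h₁) (Fin.castLE h₂))
  rw [hcompl, Set.ncard_prod, Set.ncard_prod, hc, hc, Set.ncard_univ] at this
  simp only [Nat.card_eq_fintype_card, Fintype.card_prod, Fintype.card_fin] at this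
  rw [Nat.card_coe_set_eq, Nat.mul_sub, ← this, Nat.add_sub_cancel]

/-- Truncated subtraction covers both regimes: if `r` reaches `d₁` or `d₂`, the correction is zero
and the variety is the whole space; otherwise the frame is a transcendence basis. -/
theorem ringKrullDim_quotient {σ : Type*} [Fintype σ] (r d₁ d₂ : ℕ) :
    ringKrullDim (MvPolynomial (σ × Fin d₁ × Fin d₂) ℝ ⧸
      vanishingIdeal ℝ (positiveProducts σ (Fin d₁) (Fin d₂) (Fin r))) =
      (Fintype.card σ * (d₁ * d₂ - (d₁ - r) * (d₂ - r)) : ℕ) := by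
  by_cases h : d₁ ≤ r ∨ d₂ ≤ r
  · rw [vanishingIdeal_eq_bot h, ringKrullDim_eq_of_ringEquiv (RingEquiv.quotientBot _),
      MvPolynomial.ringKrullDim_of_isNoetherianRing, ringKrullDim_eq_zero_of_field]
    have : (d₁ - r) * (d₂ - r) = 0 := by
      rcases h with h | h <;> simp [Nat.sub_eq_zero_of_le h]
    simp [this]
  · push Not at h
    have hprime := vanishingIdeal_isPrime (σ := σ) (α := Fin d₁) (β := Fin d₂) (κ := Fin r)
    have hb : Function.Injective (Fin.castLE h.1.le) := Fin.castLE_injective _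
    have hc : Function.Injective (Fin.castLE h.2.le) := Fin.castLE_injective _
    have hind := algebraicIndependent_frame (σ := σ) hb hc
    have halg := isAlgebraic_adjoin_frame (σ := σ) hb hc
    have hbasis := hind.isTranscendenceBasis_iff_isAlgebraic.2 halg
    refine ringKrullDim_eq_of_trdeg_eq (k := ℝ) ?_
    have := hbasis.lift_cardinalMk_eq_trdeg
    rw [← natCard_frame h.1.le h.2.le, Nat.cast_card]
    simpa using this.symm

end positiveProducts

/-- Relabelling the coordinates does not change the dimension of a quotient by a vanishing ideal. -/
theorem ringKrullDim_vanishingIdeal_comp_equiv {ι ι' : Type*} (e : ι ≃ ι') (M : Set (ι → ℝ)) :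
    ringKrullDim (MvPolynomial ι' ℝ ⧸ vanishingIdeal ℝ {x : ι' → ℝ | x ∘ e ∈ M}) =
      ringKrullDim (MvPolynomial ι ℝ ⧸ vanishingIdeal ℝ M) := by
  refine (ringKrullDim_eq_of_ringEquiv (Ideal.quotientEquiv _ _
    (renameEquiv ℝ e).toRingEquiv ?_)).symm
  ext f
  rw [Ideal.map_comap_of_equiv, Ideal.mem_comap]
  change _ ↔ rename e.symm f ∈ vanishingIdeal ℝ M
  simp only [mem_vanishingIdeal_iff, aeval_rename]
  constructor
  · intro h x hx
    exact h _ (by rwa [Set.mem_ofPred_eq, Function.comp_assoc, e.symm_comp_self])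
  · intro h x hx
    have := h _ hx
    rwa [Function.comp_assoc, e.self_comp_symm] at this

/-! ### Mixtures of conditional independence models -/

namespace GraphMixture

theorem mixture_one {ι : Type*} (M : Set (ι → ℝ)) : mixture 1 M = M := by
  ext p
  constructor
  · rintro ⟨w, ⟨-, hw⟩, q, hq, rfl⟩
    have : w 0 = 1 := by simpa using hw
    simpa [this] using hq 0
  · intro hp
    exact ⟨fun _ => 1, ⟨fun _ => one_pos, by simp⟩, fun _ => p, fun _ => hp, by simp⟩

theorem comp_mem_mixture_iff {ι ι' : Type*} (e : ι ≃ ι') (r : ℕ) (M : Set (ι → ℝ)) (x : ι' → ℝ) :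
    x ∘ e ∈ mixture r M ↔ x ∈ mixture r {x : ι' → ℝ | x ∘ e ∈ M} := by
  constructor
  · rintro ⟨w, hw, q, hq, h⟩
    refine ⟨w, hw, fun j => q j ∘ e.symm, fun j => ?_, ?_⟩
    · change (q j ∘ e.symm) ∘ e ∈ M
      rw [Function.comp_assoc, e.symm_comp_self]
      exact hq j
    · ext i
      have := congrFun h (e.symm i)
      simpa using this
  · rintro ⟨w, hw, q, hq, rfl⟩
    exact ⟨w, hw, fun j => q j ∘ e, hq, by ext; simp⟩

/-- Distributions on `σ × α × β` for which the last two components are independent given the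
first. -/
def conditionalIndependence (σ α β : Type*) [Fintype σ] [Fintype α] [Fintype β] :
    Set (σ × α × β → ℝ) :=
  {p | p ∈ openSimplex (σ × α × β) ∧ ∃ (f : σ → α → ℝ) (g : σ → β → ℝ),
    (∀ s a, 0 < f s a) ∧ (∀ s b, 0 < g s b) ∧ ∀ s a b, p (s, a, b) = f s a * g s b}

theorem sum_eq_one_of_mem_mixture {ι : Type*} [Fintype ι] {M : Set (ι → ℝ)}
    (hM : M ⊆ openSimplex ι) {r : ℕ} {p : ι → ℝ} (hp : p ∈ mixture r M) : ∑ i, p i = 1 := by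
  obtain ⟨w, hw, q, hq, rfl⟩ := hp
  simp only [Finset.sum_apply, Pi.smul_apply, smul_eq_mul]
  rw [Finset.sum_comm]
  simp only [← Finset.mul_sum, (hM (hq _)).2, mul_one]
  exact hw.2

/-- Column `j` of each `U s` and row `j` of each `V s` are the factors of the `j`-th component; its
weight and the cone parameter are absorbed into `U`. -/
theorem positiveCone_mixture {σ α β : Type*} [Fintype σ] [Fintype α] [Fintype β] [Nonempty σ]
    [Nonempty α] [Nonempty β] {r : ℕ} (hr : 1 ≤ r) :
    positiveCone (mixture r (conditionalIndependence σ α β)) =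
      positiveProducts σ α β (Fin r) := by
  ext x
  constructor
  · rintro ⟨t, ht, _, ⟨w, hw, q, hq, rfl⟩, rfl⟩
    choose f g hf hg h using fun j => (hq j).2
    refine ⟨fun s => Matrix.of fun a j => t * w j * f j s a, fun s => Matrix.of fun j b => g j s b,
      fun s a j => mul_pos (mul_pos ht (hw.1 j)) (hf j s a), fun s j b => hg j s b, ?_⟩
    ext ⟨s, a, b⟩
    simp [productPoint, Matrix.mul_apply, h, Finset.mul_sum, mul_assoc]
  · rintro ⟨U, V, hU, hV, rfl⟩
    have : Nonempty (Fin r) := ⟨⟨0, hr⟩⟩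
    -- The total mass of the `j`-th rank-one summand: dividing by it normalizes the component, and
    -- its share of the whole is the mixture weight.
    let W : Fin r → ℝ := fun j => ∑ i : σ × α × β, U i.1 i.2.1 j * V i.1 j i.2.2
    have hW : ∀ j, 0 < W j := fun j =>
      Finset.sum_pos (fun i _ => mul_pos (hU _ _ _) (hV _ _ _)) Finset.univ_nonempty
    have hW' : 0 < ∑ j, W j := Finset.sum_pos (fun j _ => hW j) Finset.univ_nonempty
    refine ⟨∑ j, W j, hW', _, ⟨fun j => W j / ∑ j, W j, ⟨fun j => div_pos (hW j) hW', ?_⟩,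
      fun j i => U i.1 i.2.1 j / W j * V i.1 j i.2.2, fun j => ⟨⟨fun i => ?_, ?_⟩,
        fun s a => U s a j / W j, fun s b => V s j b, fun s a => div_pos (hU _ _ _) (hW j),
        fun s b => hV _ _ _, fun s a b => rfl⟩, rfl⟩, ?_⟩
    · rw [← Finset.sum_div, div_self hW'.ne']
    · exact mul_pos (div_pos (hU _ _ _) (hW j)) (hV _ _ _)
    · simp only [div_mul_eq_mul_div]
      rw [← Finset.sum_div, div_self (hW j).ne']
    · ext ⟨s, a, b⟩
      simp only [productPoint, Matrix.mul_apply, Pi.smul_apply, Finset.sum_apply, smul_eq_mul,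
        Finset.mul_sum]
      refine Finset.sum_congr rfl fun j _ => ?_
      have := (hW j).ne'
      field_simp

theorem modelDim_mixture_conditionalIndependence {σ : Type*} [Fintype σ] [Nonempty σ]
    {r d₁ d₂ : ℕ} (hr : 1 ≤ r) (h₁ : 1 ≤ d₁) (h₂ : 1 ≤ d₂) :
    modelDim (mixture r (conditionalIndependence σ (Fin d₁) (Fin d₂))) =
      (Fintype.card σ * (d₁ * d₂ - (d₁ - r) * (d₂ - r)) - 1 : ℕ) := by
  have : Nonempty (Fin d₁) := ⟨⟨0, h₁⟩⟩
  have : Nonempty (Fin d₂) := ⟨⟨0, h₂⟩⟩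
  have h := ringKrullDim_positiveCone (M := mixture r (conditionalIndependence σ (Fin d₁) (Fin d₂)))
    (fun p hp => sum_eq_one_of_mem_mixture (fun _ h => h.1) hp)
    (by rw [positiveCone_mixture hr]; exact positiveProducts.vanishingIdeal_isPrime)
  rw [positiveCone_mixture hr, positiveProducts.ringKrullDim_quotient] at h
  -- Needed so that the truncated `- 1` undoes the `+ 1` coming from the cone.
  have hpos : 1 ≤ Fintype.card σ * (d₁ * d₂ - (d₁ - r) * (d₂ - r)) := by
    refine Nat.mul_pos Fintype.card_pos (Nat.sub_pos_of_lt ?_)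
    exact Nat.mul_lt_mul_of_lt_of_le (by omega) (by omega) (by omega)
  generalize Fintype.card σ * (d₁ * d₂ - (d₁ - r) * (d₂ - r)) = n at h hpos ⊢
  obtain ⟨m, rfl⟩ := Nat.exists_eq_add_of_le' hpos
  rw [Nat.add_sub_cancel]
  rw [Nat.cast_add, Nat.cast_one] at h
  exact (ENat.WithBot.add_one_cancel.1 h).symm

end GraphMixture

/-! ### Clique stars with two cliques as conditional independence models -/

namespace GraphMixture

section

variable {V : Type*}

/-- A clique contained in neither `K 0` nor `K 1` has a vertex outside each; these are distinct and
adjacent, but their edge lies in one of the two sets. -/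
theorem IsCliqueStar.mem_maxCliques_iff [Fintype V] [DecidableEq V]
    {G : SimpleGraph V} {K : Fin 2 → Finset V} {S : Finset V}
    (hG : IsCliqueStar G K S) (C : Finset V) : C ∈ maxCliques G ↔ C = K 0 ∨ C = K 1 := by
  simp only [maxCliques, Finset.mem_filter, Finset.mem_univ, true_and]
  constructor
  · intro hC
    by_cases h0 : C ⊆ K 0
    · exact Or.inl (hC.eq_of_le (hG.maxClique 0).prop h0)
    by_cases h1 : C ⊆ K 1
    · exact Or.inr (hC.eq_of_le (hG.maxClique 1).prop h1)
    exfalso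
    obtain ⟨v, hv, hv0⟩ := Finset.not_subset.1 h0
    obtain ⟨w, hw, hw1⟩ := Finset.not_subset.1 h1
    have hvw : v ≠ w := by
      rintro rfl
      obtain ⟨i, hi⟩ := hG.vertex_mem v
      fin_cases i
      · exact hv0 hi
      · exact hw1 hi
    obtain ⟨i, hi, hi'⟩ := hG.edge_mem v w (hC.prop hv hw hvw)
    fin_cases i
    · exact hv0 hi
    · exact hw1 hi'
  · rintro (rfl | rfl)
    exacts [hG.maxClique 0, hG.maxClique 1]

theorem IsCliqueStar.monomialMap_eq [Fintype V] [DecidableEq V]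
    {G : SimpleGraph V} {d : V → ℕ} {K : Fin 2 → Finset V}
    {S : Finset V} (hG : IsCliqueStar G K S)
    (θ : ∀ C : maxCliques G, StateOn d (C : Finset V) → ℂ) (i : State d) :
    monomialMap G d θ i = θ ⟨K 0, (hG.mem_maxCliques_iff _).2 (Or.inl rfl)⟩ (fun v => i v) *
      θ ⟨K 1, (hG.mem_maxCliques_iff _).2 (Or.inr rfl)⟩ (fun v => i v) := by
  have huniv : (Finset.univ : Finset (maxCliques G)) =
      {⟨K 0, (hG.mem_maxCliques_iff _).2 (Or.inl rfl)⟩,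
        ⟨K 1, (hG.mem_maxCliques_iff _).2 (Or.inr rfl)⟩} := by
    ext ⟨C, hC⟩
    simpa using (hG.mem_maxCliques_iff C).1 hC
  rw [monomialMap, huniv, Finset.prod_pair]
  intro h
  exact zero_ne_one (hG.injective (congrArg Subtype.val h))

theorem card_stateOn [DecidableEq V] (d : V → ℕ) (A : Finset V) : Fintype.card (StateOn d A) = numStates d A := by
  rw [Fintype.card_pi, numStates, ← Finset.prod_coe_sort A]
  simp only [Fintype.card_fin]

/-- The states of a union of two sets decompose into those of the intersection and of the two
differences. -/
theorem exists_equiv_stateOn [Fintype V] [DecidableEq V]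
    {d : V → ℕ} {A B S : Finset V} (hAB : ∀ v, v ∈ A ∨ v ∈ B)
    (hS : A ∩ B = S) :
    ∃ e : State d ≃ StateOn d S × Fin (numStates d (A \ S)) × Fin (numStates d (B \ S)),
      (∀ i i', (∀ v ∈ A, i v = i' v) ↔ (e i).1 = (e i').1 ∧ (e i).2.1 = (e i').2.1) ∧
      (∀ i i', (∀ v ∈ B, i v = i' v) ↔ (e i).1 = (e i').1 ∧ (e i).2.2 = (e i').2.2) := by
  subst hS
  let f : State d → StateOn d (A ∩ B) × StateOn d (A \ (A ∩ B)) × StateOn d (B \ (A ∩ B)) :=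
    fun i => (fun v => i v, fun v => i v, fun v => i v)
  have hA : ∀ i i' : State d, (∀ v ∈ A, i v = i' v) ↔ (f i).1 = (f i').1 ∧ (f i).2.1 = (f i').2.1 := by
    intro i i'
    simp only [f, funext_iff, Subtype.forall, Finset.mem_inter, Finset.mem_sdiff]
    exact ⟨fun h => ⟨fun v hv => h v hv.1, fun v hv => h v hv.1⟩, fun h v hv => by
      by_cases hvB : v ∈ B
      · exact h.1 v ⟨hv, hvB⟩
      · exact h.2 v ⟨hv, fun h => hvB h.2⟩⟩
  have hB : ∀ i i' : State d, (∀ v ∈ B, i v = i' v) ↔ (f i).1 = (f i').1 ∧ (f i).2.2 = (f i').2.2 := by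
    intro i i'
    simp only [f, funext_iff, Subtype.forall, Finset.mem_inter, Finset.mem_sdiff]
    exact ⟨fun h => ⟨fun v hv => h v hv.2, fun v hv => h v hv.1⟩, fun h v hv => by
      by_cases hvA : v ∈ A
      · exact h.1 v ⟨hvA, hv⟩
      · exact h.2 v ⟨hv, fun h => hvA h.1⟩⟩
  have hf : Function.Bijective f := by
    constructor
    · intro i i' h
      have h1 := (hA i i').2 (by simp [h])
      have h2 := (hB i i').2 (by simp [h])
      funext v
      exact (hAB v).elim (h1 v) (h2 v)
    · rintro ⟨s, a, b⟩
      refine ⟨fun v => if h : v ∈ A ∩ B then s ⟨v, h⟩ else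
        if h' : v ∈ A \ (A ∩ B) then a ⟨v, h'⟩ else
          b ⟨v, Finset.mem_sdiff.2 ⟨(hAB v).resolve_left fun hv =>
            h' (Finset.mem_sdiff.2 ⟨hv, h⟩), h⟩⟩, ?_⟩
      refine Prod.ext ?_ (Prod.ext ?_ ?_)
      · funext v
        simp only [f]
        rw [dif_pos v.2]
      · funext v
        simp only [f]
        rw [dif_neg (Finset.mem_sdiff.1 v.2).2, dif_pos v.2]
      · funext v
        simp only [f]
        have hv := Finset.mem_sdiff.1 v.2
        rw [dif_neg hv.2, dif_neg fun h =>
          hv.2 (Finset.mem_inter.2 ⟨(Finset.mem_sdiff.1 h).1, hv.1⟩)]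
  refine ⟨(Equiv.ofBijective f hf).trans (Equiv.prodCongr (Equiv.refl _) (Equiv.prodCongr
    (Fintype.equivFinOfCardEq (card_stateOn d _)) (Fintype.equivFinOfCardEq (card_stateOn d _)))),
    fun i i' => ?_, fun i i' => ?_⟩
  · simpa using hA i i'
  · simpa using hB i i'

/-- The affine dimension of the matrices of rank at most `r`. -/
theorem rank_dimension_eq_min {r d₁ d₂ : ℕ} (h : r ≤ max d₁ d₂) :
    d₁ * d₂ - (d₁ - r) * (d₂ - r) = min (r * (d₁ + d₂ - r)) (d₁ * d₂) := by
  wlog h' : d₁ ≤ d₂ generalizing d₁ d₂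
  · have := this (max_comm d₁ d₂ ▸ h) (not_le.1 h').le
    rwa [mul_comm d₂, mul_comm (d₂ - r), add_comm] at this
  rw [max_eq_right h'] at h
  obtain ⟨b, rfl⟩ := Nat.exists_eq_add_of_le h
  rw [Nat.add_sub_cancel_left, show d₁ + (r + b) - r = d₁ + b by omega]
  -- With `a` the distance from `r` to `d₁` and `b = d₂ - r`, the two entries of the minimum differ
  -- by `a * b`; the side on which `r` lies decides which is smaller.
  rcases le_total r d₁ with h₁ | h₁
  · obtain ⟨a, rfl⟩ := Nat.exists_eq_add_of_le h₁
    rw [Nat.add_sub_cancel_left,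
      show (r + a) * (r + b) = r * (r + a + b) + a * b by ring, Nat.add_sub_cancel,
      min_eq_left (Nat.le_add_right _ _)]
  · obtain ⟨a, rfl⟩ := Nat.exists_eq_add_of_le h₁
    rw [Nat.sub_eq_zero_of_le h₁, zero_mul, Nat.sub_zero, min_eq_right]
    nlinarith [Nat.zero_le (a * b)]

/-- The source of defectivity: `r` independent rank-one summands would give `r * (d₁ + d₂ - 1)`
parameters, more than the rank-`r` matrices have. -/
theorem rank_dimension_lt {r d₁ d₂ : ℕ} (h₁ : 1 ≤ d₁) (h₂ : 1 ≤ d₂) (hr : 2 ≤ r) :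
    d₁ * d₂ - (d₁ - r) * (d₂ - r) < r * (d₁ + d₂ - 1) := by
  rcases le_total r (max d₁ d₂) with h | h
  · rw [rank_dimension_eq_min h]
    refine (min_le_left _ _).trans_lt (Nat.mul_lt_mul_of_pos_left ?_ (by omega))
    omega
  · refine (Nat.sub_le _ _).trans_lt ?_
    obtain ⟨a, rfl⟩ := Nat.exists_eq_add_of_le' h₁
    obtain ⟨b, rfl⟩ := Nat.exists_eq_add_of_le' h₂
    rw [show a + 1 + (b + 1) - 1 = a + b + 1 by omega]
    have h₃ : a + 1 ≤ r := (le_max_left _ _).trans h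
    nlinarith [Nat.mul_le_mul_right b h₃, Nat.mul_le_mul_right a hr]

/-- A positive family of matrices that factors over `ℂ` as rank-one matrices does so with positive
real factors. -/
theorem exists_pos_of_complex_factorization {σ α β : Type*} [Nonempty α] [Nonempty β]
    {p : σ × α × β → ℝ} (hp : ∀ i, 0 < p i) {F : σ → α → ℂ} {H : σ → β → ℂ}
    (h : ∀ s a b, (p (s, a, b) : ℂ) = F s a * H s b) :
    ∃ (f : σ → α → ℝ) (g : σ → β → ℝ),
      (∀ s a, 0 < f s a) ∧ (∀ s b, 0 < g s b) ∧ ∀ s a b, p (s, a, b) = f s a * g s b := by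
  obtain ⟨a₀⟩ := ‹Nonempty α›
  obtain ⟨b₀⟩ := ‹Nonempty β›
  -- Real factors are read off from the row and column through a base point; the vanishing of a 2 ×
  -- 2 minor makes them work.
  refine ⟨fun s a => p (s, a, b₀), fun s b => p (s, a₀, b) / p (s, a₀, b₀), fun s a => hp _,
    fun s b => div_pos (hp _) (hp _), fun s a b => ?_⟩
  have h0 := (hp (s, a₀, b₀)).ne'
  have key : p (s, a, b) * p (s, a₀, b₀) = p (s, a, b₀) * p (s, a₀, b) := by
    have : (p (s, a, b) : ℂ) * p (s, a₀, b₀) = p (s, a, b₀) * p (s, a₀, b) := by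
      simp only [h]
      ring
    exact_mod_cast this
  field_simp
  exact key

/-- By `h0` and `h1`, restricting a state to `K 0` or `K 1` amounts to keeping `(s, a)` or `(s, b)`,
so clique parameters are functions of these pairs. -/
theorem IsCliqueStar.comp_mem_graphicalModel_iff [Fintype V] [DecidableEq V]
    {σ α β : Type*} [Fintype σ] [Fintype α]
    [Fintype β] [Nonempty α] [Nonempty β] {G : SimpleGraph V} {d : V → ℕ} (hd : ∀ v, 1 ≤ d v)
    {K : Fin 2 → Finset V} {S : Finset V} (hG : IsCliqueStar G K S) (e : State d ≃ σ × α × β)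
    (h0 : ∀ i i', (∀ v ∈ K 0, i v = i' v) ↔ (e i).1 = (e i').1 ∧ (e i).2.1 = (e i').2.1)
    (h1 : ∀ i i', (∀ v ∈ K 1, i v = i' v) ↔ (e i).1 = (e i').1 ∧ (e i).2.2 = (e i').2.2)
    (p : σ × α × β → ℝ) :
    p ∘ e ∈ graphicalModel G d ↔ p ∈ conditionalIndependence σ α β := by
  have hsimplex : p ∘ e ∈ openSimplex (State d) ↔ p ∈ openSimplex (σ × α × β) := by
    refine and_congr (e.forall_congr_left.trans (by simp)) ?_
    rw [← e.sum_comp p]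
    rfl
  constructor
  · rintro ⟨hs, θ, hθ⟩
    have hs' := hsimplex.1 hs
    obtain ⟨a₀⟩ := id ‹Nonempty α›
    obtain ⟨b₀⟩ := id ‹Nonempty β›
    refine ⟨hs', exists_pos_of_complex_factorization hs'.1
      (F := fun s a => θ ⟨K 0, (hG.mem_maxCliques_iff _).2 (Or.inl rfl)⟩
        fun v => e.symm (s, a, b₀) v)
      (H := fun s b => θ ⟨K 1, (hG.mem_maxCliques_iff _).2 (Or.inr rfl)⟩
        fun v => e.symm (s, a₀, b) v) fun s a b => ?_⟩
    have h := hθ (e.symm (s, a, b))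
    rw [hG.monomialMap_eq, Function.comp_apply, e.apply_symm_apply] at h
    rw [← h]
    congr 2
    · funext v
      exact (h0 _ _).2 (by simp) v v.2
    · funext v
      exact (h1 _ _).2 (by simp) v v.2
  · rintro ⟨hs, f, g, -, -, h⟩
    -- The default state 0 outside `C` is harmless: the components read off afterwards depend only
    -- on the values on the clique.
    let ext : ∀ C : Finset V, StateOn d C → State d :=
      fun C j v => if h : v ∈ C then j ⟨v, h⟩ else ⟨0, hd v⟩
    have hext : ∀ C (i : State d), ∀ v ∈ C, ext C (fun v => i v) v = i v := by
      intro C i v hv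
      simp [ext, hv]
    refine ⟨hsimplex.2 hs, fun C j => if C.1 = K 0 then
      (f (e (ext C j)).1 (e (ext C j)).2.1 : ℂ) else g (e (ext C j)).1 (e (ext C j)).2.2,
      fun i => ?_⟩
    have h01 : K 1 ≠ K 0 := fun h => one_ne_zero (hG.injective h)
    have hi0 := (h0 _ _).1 (hext (K 0) i)
    have hi1 := (h1 _ _).1 (hext (K 1) i)
    rw [hG.monomialMap_eq]
    simp only [if_true, if_neg h01]
    rw [hi0.1, hi0.2, hi1.1, hi1.2, ← Complex.ofReal_mul, ← h]
    rfl

theorem numStates_pos {d : V → ℕ} (hd : ∀ v, 1 ≤ d v) (A : Finset V) : 1 ≤ numStates d A := by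
  have : 0 < ∏ v ∈ A, d v := Finset.prod_pos fun v _ => hd v
  exact this

theorem IsCliqueStar.modelDim_mixture [Fintype V] [DecidableEq V]
    {G : SimpleGraph V} {d : V → ℕ} (hd : ∀ v, 1 ≤ d v)
    {K : Fin 2 → Finset V} {S : Finset V} (hG : IsCliqueStar G K S) {r : ℕ} (hr : 1 ≤ r) :
    modelDim (mixture r (graphicalModel G d)) =
      (numStates d S * (numStates d (K 0 \ S) * numStates d (K 1 \ S) -
        (numStates d (K 0 \ S) - r) * (numStates d (K 1 \ S) - r)) - 1 : ℕ) := by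
  have hA := numStates_pos hd (K 0 \ S)
  have hB := numStates_pos hd (K 1 \ S)
  obtain ⟨e, h0, h1⟩ := exists_equiv_stateOn (d := d) (A := K 0) (B := K 1) (S := S)
    (fun v => by
      obtain ⟨i, hi⟩ := hG.vertex_mem v
      fin_cases i
      exacts [Or.inl hi, Or.inr hi]) (hG.inter_eq 0 1 (by decide))
  have : Nonempty (Fin (numStates d (K 0 \ S))) := ⟨⟨0, hA⟩⟩
  have : Nonempty (Fin (numStates d (K 1 \ S))) := ⟨⟨0, hB⟩⟩
  have : Nonempty (StateOn d S) := ⟨fun v => ⟨0, hd v⟩⟩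
  rw [← card_stateOn d S, ← modelDim_mixture_conditionalIndependence hr hA hB, modelDim, modelDim,
    ← ringKrullDim_vanishingIdeal_comp_equiv e]
  have : {x | x ∘ e ∈ mixture r (graphicalModel G d)} = mixture r (conditionalIndependence
      (StateOn d S) (Fin (numStates d (K 0 \ S))) (Fin (numStates d (K 1 \ S)))) := by
    ext x
    rw [Set.mem_ofPred_eq, comp_mem_mixture_iff]
    have : {x | x ∘ e ∈ graphicalModel G d} = conditionalIndependence (StateOn d S)
        (Fin (numStates d (K 0 \ S))) (Fin (numStates d (K 1 \ S))) :=
      Set.ext fun p => hG.comp_mem_graphicalModel_iff hd e h0 h1 p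
    rw [this]
  rw [this]

end

end GraphMixture

/-! ### The dimension formulas and defectivity -/

open GraphMixture in
theorem corollary3p4 {V : Type*} [Fintype V] [DecidableEq V] (G : SimpleGraph V)
    (d : V → ℕ) (hd : ∀ v, 1 ≤ d v)
    (K : Fin 2 → Finset V) (S : Finset V) (hG : IsCliqueStar G K S)
    (dS d₁ d₂ : ℕ) (hdS : dS = numStates d S)
    (hd₁ : d₁ = numStates d (K 0 \ S)) (hd₂ : d₂ = numStates d (K 1 \ S))
    (r : ℕ) (hr : 1 ≤ r) :
    (r ≤ max d₁ d₂ →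
      modelDim (mixture r (graphicalModel G d)) =
        ((min (dS * (r * (d₁ + d₂ - r)) - 1) (dS * d₁ * d₂ - 1) : ℕ) : WithBot ℕ∞)) ∧
    (max d₁ d₂ ≤ r →
      modelDim (mixture r (graphicalModel G d)) =
        ((dS * d₁ * d₂ - 1 : ℕ) : WithBot ℕ∞)) ∧
    (2 ≤ r → IsDefective r (graphicalModel G d)) := by
  have hdim : ∀ r, 1 ≤ r → modelDim (mixture r (graphicalModel G d)) =
      (dS * (d₁ * d₂ - (d₁ - r) * (d₂ - r)) - 1 : ℕ) := by
    intro r hr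
    rw [hdS, hd₁, hd₂]
    exact hG.modelDim_mixture hd hr
  have pS : 1 ≤ dS := hdS ▸ numStates_pos hd S
  have p₁ : 1 ≤ d₁ := hd₁ ▸ numStates_pos hd _
  have p₂ : 1 ≤ d₂ := hd₂ ▸ numStates_pos hd _
  clear hdS hd₁ hd₂
  refine ⟨fun h => ?_, fun h => ?_, fun h => ?_⟩
  · rw [hdim r hr, Nat.cast_inj, Nat.sub_min_sub_right, mul_assoc, Nat.mul_min_mul_left,
      rank_dimension_eq_min h]
  · rw [hdim r hr, Nat.sub_eq_zero_of_le (le_of_max_le_left h), zero_mul, Nat.sub_zero, mul_assoc]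
  · have h1 := hdim 1 le_rfl
    rw [mixture_one] at h1
    rw [IsDefective, expectedDim, h1, hdim r hr, ← Nat.cast_mul, ← Nat.cast_add, Nat.cast_lt]
    have key := rank_dimension_lt p₁ p₂ h
    -- The case `r = 1`, giving the dimension of the model itself.
    have hone : d₁ * d₂ - (d₁ - 1) * (d₂ - 1) = d₁ + d₂ - 1 := by
      obtain ⟨a, rfl⟩ := Nat.exists_eq_add_of_le' p₁
      obtain ⟨b, rfl⟩ := Nat.exists_eq_add_of_le' p₂
      simp only [Nat.add_sub_cancel]
      have : (a + 1) * (b + 1) = a * b + (a + 1 + (b + 1) - 1) := by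
        rw [show a + 1 + (b + 1) - 1 = a + b + 1 by omega]
        ring
      rw [this, Nat.add_sub_cancel_left]
    rw [hone]
    have hpos : 1 ≤ dS * (d₁ + d₂ - 1) := Nat.mul_pos pS (by omega)
    have hlt := Nat.mul_lt_mul_of_pos_left key pS
    -- The `r` normalizations cost `r` and the weights restore `r - 1`, so the expected dimension is
    -- one less than `r` times the dimension of the cone over the model.
    have : r * (dS * (d₁ + d₂ - 1) - 1) + (r - 1) = dS * (r * (d₁ + d₂ - 1)) - 1 := by
      obtain ⟨m, hm⟩ := Nat.exists_eq_add_of_le' hpos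
      rw [Nat.mul_left_comm, hm, Nat.add_sub_cancel, Nat.mul_add, mul_one]
      omega
    omega
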